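/- Let $V$ be a finite set. A simplicial complex with vertices in $V$ is a family $K$ of subsets of $V$, called simplices, which contains $\emptyset$ and is closed under passing to subsets; $|K|$ denotes its geometric realization and $\Sigma|K|$ the unreduced suspension of $|K|$, i.e. $|K|\times[0,1]$ with each of its two ends collapsed to a point (the suspension of the empty space being $S^0$); equivalently, $\Sigma|K|=|\Sigma K|$. Take as basepoint of $\Sigma|K|$ the point to which $|K|\times\{0\}$ is collapsed. A minimal non-face of $K$ is a subset $\sigma\subset V$ which is not a simplex of $K$ but all of whose proper subsets are simplices of $K$. A filling of $K$ is a collection $\mathcal F=\{\sigma_1,\ldots,\sigma_r\}$ (possibly empty) of minimal non-faces of $K$ such that $|K\cup\sigma_1\cup\cdots\cup\sigma_r|$ is contractible; $K$ is fillable if it has a filling. Then to all pairs $(K,\mathcal F(K))$ of a fillable complex $K$ with vertices in $V$ and a filling $\mathcal F(K)$ of $K$ one can assign homotopy equivalences $$\epsilon_{K}=\epsilon_{K,\mathcal F(K)}\colon|\Sigma K|\xrightarrow{\ \simeq\ }\bigvee_{\sigma\in\mathcal F(K)}S^{|\sigma|-1}$$ preserving basepoints (the empty wedge being a point), such that the following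 holds. For all $(K,\mathcal F(K))$, and for every fillable subcomplex $L\subset K$ with a filling $\mathcal F(L)$ satisfying $\mathcal F(L)\subset\mathcal F(K)\cup K$, the square $$\begin{array}{ccc}|\Sigma L|&\xrightarrow{\ \epsilon_L\ }&\bigvee_{\tau\in\mathcal F(L)}S^{|\tau|-1}\\ \downarrow&&\downarrow{\scriptstyle\widetilde g}\\ |\Sigma K|&\xrightarrow{\ \epsilon_K\ }&\bigvee_{\sigma\in\mathcal F(K)}S^{|\sigma|-1}\end{array}$$ commutes up to a homotopy fixing the basepoint. Here the left vertical map is induced by the inclusion $L\subset K$, and $\widetilde g|_{S^{|\tau|-1}}$ is the inclusion of the wedge summand indexed by $\tau$ if $\tau\in\mathcal F(K)\cap\mathcal F(L)$, and the constant map to the basepoint otherwise. -/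

import Mathlib

noncomputable section

namespace Fillable

/-! ### Simplicial complexes -/

section Complex

variable {V : Type*}

/-- The geometric realization of a simplicial complex with vertices in a finite set `V`, in
barycentric coordinates: the union of the closed faces of the standard simplex on `V` that are
spanned by the simplices of `K`, with the subspace topology of `V → ℝ`. -/
def realization [Fintype V] (K : PreAbstractSimplicialComplex V) : Set (V → ℝ) :=
  {x | x ∈ stdSimplex ℝ V ∧ ∃ s ∈ K.faces, ∀ v, v ∉ s → x v = 0}

theorem realization_mono [Fintype V] {L K : PreAbstractSimplicialComplex V} (h : L ≤ K) :
    realization L ⊆ realization K :=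
  fun _ ⟨hx, s, hs, hv⟩ => ⟨hx, s, h hs, hv⟩

/-- The inclusion of realizations of a subcomplex `L` of `K`. -/
def realizationIncl [Fintype V] {L K : PreAbstractSimplicialComplex V} (h : L ≤ K) :
    C(realization L, realization K) :=
  ⟨Set.inclusion (realization_mono h), continuous_inclusion (realization_mono h)⟩

/-- A minimal non-face: a subset that is not a simplex, all of whose proper subsets are simplices.
(The empty simplex, which is not listed in Mathlib's `faces`, counts as a simplex
of every complex, hence the two conditions `Nonempty`.) -/
def IsMinimalNonface (K : PreAbstractSimplicialComplex V) (σ : Finset V) : Prop :=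
  σ.Nonempty ∧ σ ∉ K.faces ∧ ∀ τ : Finset V, τ ⊂ σ → τ.Nonempty → τ ∈ K.faces

/-- The simplicial complex obtained from `K` by adding a collection of minimal non-faces. -/
def addFaces (K : PreAbstractSimplicialComplex V) (F : Set (Finset V))
    (hF : ∀ σ ∈ F, IsMinimalNonface K σ) : PreAbstractSimplicialComplex V where
  faces := K.faces ∪ F
  isRelLowerSet_faces := by
    rintro s (hs | hs)
    · exact ⟨(K.isRelLowerSet_faces hs).1,
        fun t hts ht => Or.inl ((K.isRelLowerSet_faces hs).2 hts ht)⟩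
    · refine ⟨(hF s hs).1, fun t hts ht => ?_⟩
      rcases eq_or_lt_of_le hts with rfl | h
      · exact Or.inr hs
      · exact Or.inl ((hF s hs).2.2 t h ht)

/-- `F` is a filling of `K`: a collection of minimal non-faces of `K` such that the complex
obtained from `K` by adding them has contractible realization. A complex is fillable
if it has a filling. -/
structure IsFilling [Fintype V] (K : PreAbstractSimplicialComplex V) (F : Set (Finset V)) :
    Prop where
  minimal : ∀ σ ∈ F, IsMinimalNonface K σ
  contractible : ContractibleSpace (realization (addFaces K F minimal))

end Complex

/-! ### Suspensions -/

section Suspension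

variable (X : Type*) [TopologicalSpace X]

/-- The relation that glues the two ends of the cylinder `X × [0,1]` to the two poles. -/
inductive SuspensionRel : Bool ⊕ X × unitInterval → Bool ⊕ X × unitInterval → Prop
  | bottom (x : X) : SuspensionRel (Sum.inr (x, 0)) (Sum.inl false)
  | top (x : X) : SuspensionRel (Sum.inr (x, 1)) (Sum.inl true)

/-- The unreduced suspension of `X`: the cylinder `X × [0,1]` with each of its two ends collapsed
to a pole (so the suspension of the empty space is the two-point space). -/
def Suspension : Type _ := Quot (SuspensionRel X)

instance : TopologicalSpace (Suspension X) := inferInstanceAs (TopologicalSpace (Quot _))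

/-- The basepoint of the suspension: the pole to which `X × {0}` is collapsed. -/
def Suspension.base : Suspension X := Quot.mk _ (Sum.inl false)

variable {X} {Y : Type*} [TopologicalSpace Y]

/-- The suspension of a map, `(x, t) ↦ (f x, t)`. -/
def Suspension.map (f : C(X, Y)) : C(Suspension X, Suspension Y) where
  toFun := Quot.map (Sum.map id (Prod.map f id)) (by
    rintro _ _ (x | x)
    · exact SuspensionRel.bottom (f x)
    · exact SuspensionRel.top (f x))
  continuous_toFun :=
    continuous_quot_lift _ (continuous_quot_mk.comp
      (continuous_id.sumMap (f.continuous.prodMap continuous_id)))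

end Suspension

/-! ### Wedges -/

section Wedge

variable {ι : Type*} (X : ι → Type*) [∀ i, TopologicalSpace (X i)] (p : ∀ i, X i)

/-- The relation that glues all basepoints to one extra point. -/
inductive WedgeRel : Unit ⊕ (Σ i, X i) → Unit ⊕ (Σ i, X i) → Prop
  | glue (i : ι) : WedgeRel (Sum.inr ⟨i, p i⟩) (Sum.inl ())

/-- The wedge of the pointed spaces `(X i, p i)`; the wedge of the empty family is a point. -/
def Wedge : Type _ := Quot (WedgeRel X p)

instance : TopologicalSpace (Wedge X p) := inferInstanceAs (TopologicalSpace (Quot _))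

/-- The basepoint of a wedge. -/
def Wedge.base : Wedge X p := Quot.mk _ (Sum.inl ())

/-- The inclusion of a wedge summand. -/
def Wedge.incl (i : ι) : C(X i, Wedge X p) where
  toFun x := Quot.mk _ (Sum.inr ⟨i, x⟩)
  continuous_toFun := continuous_quot_mk.comp (continuous_inr.comp continuous_sigmaMk)

theorem Wedge.incl_base (i : ι) : Wedge.incl X p i (p i) = Wedge.base X p :=
  Quot.sound (WedgeRel.glue i)

variable {X p} {Y : Type*} [TopologicalSpace Y]

/-- The map from a wedge given by a family of maps that send the basepoints to one point `y`. -/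
def Wedge.desc (y : Y) (f : ∀ i, C(X i, Y)) (hf : ∀ i, f i (p i) = y) : C(Wedge X p, Y) where
  toFun := Quot.lift (Sum.elim (fun _ => y) (fun z => f z.1 z.2)) (by
    rintro _ _ ⟨i⟩
    exact hf i)
  continuous_toFun := continuous_quot_lift _
    (continuous_const.sumElim (continuous_sigma fun i => (f i).continuous))

end Wedge

/-! ### Wedges of spheres -/

section SphereWedge

/-- The unit sphere `S ^ n` in `ℝ ^ (n + 1)`. -/
abbrev Sphere (n : ℕ) : Type := Metric.sphere (0 : EuclideanSpace ℝ (Fin (n + 1))) 1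

/-- The basepoint `(1, 0, …, 0)` of `S ^ n`. -/
def Sphere.base (n : ℕ) : Sphere n := ⟨EuclideanSpace.single 0 1, by simp⟩

variable {V : Type*}

/-- The wedge of the spheres `S ^ (|σ| - 1)` over the members `σ` of a collection of
(non-empty) finite subsets. -/
abbrev SphereWedge (F : Set (Finset V)) : Type _ :=
  Wedge (fun σ : F => Sphere (σ.1.card - 1)) (fun σ => Sphere.base (σ.1.card - 1))

/-- The basepoint of the wedge of spheres. -/
abbrev SphereWedge.base (F : Set (Finset V)) : SphereWedge F :=
  Wedge.base (fun σ : F => Sphere (σ.1.card - 1)) (fun σ => Sphere.base (σ.1.card - 1))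

open Classical in
/-- The map of wedges of spheres which, on the summand of `τ ∈ F`, is the inclusion of the summand
of `τ` if `τ ∈ G` and the constant map to the basepoint otherwise. -/
def SphereWedge.map (F G : Set (Finset V)) : C(SphereWedge F, SphereWedge G) :=
  Wedge.desc (SphereWedge.base G)
    (fun τ => if h : τ.1 ∈ G then
        Wedge.incl (fun σ : G => Sphere (σ.1.card - 1)) (fun σ => Sphere.base (σ.1.card - 1))
          ⟨τ.1, h⟩
      else ContinuousMap.const _ (SphereWedge.base G))
    (fun τ => by
      split_ifs with h
      · exact Wedge.incl_base (fun σ : G => Sphere (σ.1.card - 1))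
          (fun σ => Sphere.base (σ.1.card - 1)) ⟨τ.1, h⟩
      · rfl)

end SphereWedge

end Fillable

end

/-!
Let `A` be the realization of `K ∪ F` and `X ⊆ A` that of `K`. The quotient `A / X` is the wedge
of the spheres of the members of `F`, and as `A` is contractible, the suspension of `X` is homotopy
equivalent to `A / X`. The equivalence can be written down: if `H` is a contraction of `A`, it sends
`(x, t)` to the class of `H x t`, which is the class of `X` for `t = 0` and does not depend on `x`
for `t = 1` (`CollaredCollapse.suspensionMap`).

A homotopy inverse is the connecting map of the pair `(A, X)`. It comes from a deformation of `A`
into the mapping cylinder of `X → A` that stretches every added face `σ` linearly from its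
barycenter: the inner part of `σ` covers all of `σ`, and a point that would leave `σ` stops on the
boundary and moves down the cylinder over it, until the boundary has arrived at the bottom
(`stretch`, `stretchHeight`). Collapsing `A` in the cylinder gives the connecting map `A / X → ΣX`.
Both homotopies (`CollaredCollapse.homotopic_connectingMap_comp` and
`CollaredCollapse.homotopic_comp_connectingMap`) are explicit in terms of `H` and this deformation.

The condition on the filling `G` of `L` says exactly that `L ∪ G` is a subcomplex of `K ∪ F`, so
that `(L ∪ G, L)` maps to `(K ∪ F, K)`, and the map of quotients is the given map of wedges
(`collapse_naturality`). So the square commutes up to the choice of the contractions, and any two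
contractions lead to maps that are homotopic relative to the basepoint
(`CollaredCollapse.homotopicRel_suspensionMap`).

The identification of `A / X` with the wedge needs, for each `n`, a map from the `n`-simplex to the
sphere `S ^ n` that collapses the boundary to the basepoint and is bijective elsewhere
(`simplexToSphere`). It is the radial homeomorphism of the open simplex to a Euclidean space
followed by the inverse stereographic projection.
-/

noncomputable section

open Topology unitInterval

namespace Fillable

/-! ### Maps out of suspensions -/

section SuspensionLift

variable {X Y T : Type*} [TopologicalSpace X] [TopologicalSpace Y] [TopologicalSpace T]

/-- The image in the suspension of a point of the cylinder. -/
def Suspension.mk (z : X × I) : Suspension X := Quot.mk _ (Sum.inr z)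

/-- One of the two poles: `false` is the bottom pole, which is the basepoint, `true` the top. -/
def Suspension.pole (X : Type*) [TopologicalSpace X] (b : Bool) : Suspension X :=
  Quot.mk _ (Sum.inl b)

theorem Suspension.mk_zero (x : X) : Suspension.mk (x, 0) = Suspension.pole X false :=
  Quot.sound (SuspensionRel.bottom x)

theorem Suspension.mk_one (x : X) : Suspension.mk (x, 1) = Suspension.pole X true :=
  Quot.sound (SuspensionRel.top x)

theorem Suspension.continuous_mk : Continuous (Suspension.mk : X × I → Suspension X) :=
  continuous_quot_mk.comp continuous_inr

@[elab_as_elim]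
theorem Suspension.ind {P : Suspension X → Prop} (hp : ∀ b, P (Suspension.pole X b))
    (hm : ∀ x τ, P (Suspension.mk (x, τ))) (z : Suspension X) : P z := by
  obtain ⟨w⟩ := z
  rcases w with b | ⟨x, τ⟩
  · exact hp b
  · exact hm x τ

/-- The map out of a suspension given by a map on the cylinder that is constant on both ends. The
values `y b` at the poles are given separately, as `X` may be empty. -/
def Suspension.lift (y : Bool → Y) (g : X × I → Y) (h₀ : ∀ x, g (x, 0) = y false)
    (h₁ : ∀ x, g (x, 1) = y true) : Suspension X → Y :=
  Quot.lift (Sum.elim y g) (by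
    rintro _ _ (x | x)
    · exact h₀ x
    · exact h₁ x)

/-- Continuity of a family of maps out of a suspension can be tested on the cylinder and the
poles, if the parameter space is locally compact. -/
theorem Suspension.continuous_prod [LocallyCompactSpace T] {G : T × Suspension X → Y}
    (hp : ∀ b, Continuous fun t => G (t, Suspension.pole X b))
    (hm : Continuous fun p : T × (X × I) => G (p.1, Suspension.mk p.2)) : Continuous G := by
  have hq : IsQuotientMap (Quot.mk (SuspensionRel X)) := isQuotientMap_quot_mk
  refine hq.continuous_lift_prod_right (Y := T) (g := G) ?_
  rw [← (Homeomorph.prodSumDistrib (X := T) (Y := Bool) (Z := X × I)).symm.comp_continuous_iff']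
  refine continuous_sum_dom.2 ⟨?_, hm⟩
  exact continuous_prod_of_discrete_right.2 hp

theorem Suspension.continuous_lift {y : Bool → Y} {g : X × I → Y} (h₀ : ∀ x, g (x, 0) = y false)
    (h₁ : ∀ x, g (x, 1) = y true) (hg : Continuous g) :
    Continuous (Suspension.lift y g h₀ h₁) :=
  continuous_quot_lift _ (continuous_of_discreteTopology.sumElim hg)

end SuspensionLift

/-! ### Sweeping a path around two sides of a square -/

section Sweep

/-- The function `s ↦ min 1 (2 s)` of the unit interval. -/
def ramp : C(I, I) where
  toFun s := ⟨min 1 (2 * (s : ℝ)), le_min zero_le_one (by have := s.2.1; linarith), min_le_left _ _⟩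
  continuous_toFun := by fun_prop

@[simp] theorem ramp_zero : ramp 0 = 0 := by ext; simp [ramp]

@[simp] theorem ramp_one : ramp 1 = 1 := by ext; simp [ramp]

/-- For each `s`, the point `(ramp (1 - s), ramp s)` lies on the union of the two sides of the
unit square that do not contain the origin. -/
theorem ramp_symm_eq_one_or (s : I) : ramp (σ s) = 1 ∨ ramp s = 1 := by
  rcases le_total (s : ℝ) (1 / 2) with h | h
  · left; ext; simp [ramp]; linarith
  · right; ext; simp [ramp]; linarith

end Sweep

/-! ### Collapsing a collared subspace of a contractible space -/

section Collapse

/-- A closed subspace `X` of `A` with a quotient map `proj : A → W` that collapses `X` to the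
point `base`, and a deformation of `A` into the mapping cylinder `A ∪ X × [0, 1]` of the inclusion
that stretches `A` over the whole cylinder. A point of the cylinder is encoded as a pair of a point
of `A` and a height, which is `1` off `X`; the deformation is given by the coordinates `push` and
`height`, and at time `s` it lowers the points of `X` to height `1 - s`. The collapse is expressed
as a quotient map from `A` with an extra point, as `X` may be empty. -/
structure CollaredCollapse (X A W : Type*) [TopologicalSpace X] [TopologicalSpace A]
    [TopologicalSpace W] where
  incl : C(X, A)
  isClosedEmbedding : IsClosedEmbedding incl
  proj : C(A, W)
  base : W
  isQuotientMap : IsQuotientMap (Sum.elim (fun _ : Unit => base) proj)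
  proj_incl : ∀ x, proj (incl x) = base
  eq_or_of_proj_eq : ∀ a a', proj a = proj a' → a = a' ∨ a ∈ Set.range incl ∧ a' ∈ Set.range incl
  mem_of_proj_eq_base : ∀ a, proj a = base → a ∈ Set.range incl
  push : C(A × I, A)
  height : C(A × I, I)
  push_zero : ∀ a, push (a, 0) = a
  height_zero : ∀ a, height (a, 0) = 1
  push_incl : ∀ x s, push (incl x, s) = incl x
  height_incl : ∀ x s, height (incl x, s) = σ s
  push_mem : ∀ a s, height (a, s) ≠ 1 → push (a, s) ∈ Set.range incl

variable {X A W Y T : Type*} [TopologicalSpace X] [TopologicalSpace A] [TopologicalSpace W]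
  [TopologicalSpace Y] [TopologicalSpace T]

open Classical in
/-- The map from the mapping cylinder `X × [0, 1] ∪ A × {1}` of an inclusion `X → A` to the
suspension of `X` that collapses `A`, extended by the top pole to the rest of `A × [0, 1]`. -/
def cylinderToSuspension (i : C(X, A)) (z : A × I) : Suspension X :=
  if h : z.2 ≠ 1 ∧ z.1 ∈ Set.range i then Suspension.mk (h.2.choose, z.2)
  else Suspension.pole X true

theorem cylinderToSuspension_one (i : C(X, A)) (a : A) :
    cylinderToSuspension i (a, 1) = Suspension.pole X true := by
  simp [cylinderToSuspension]

theorem cylinderToSuspension_incl {i : C(X, A)} (hi : Function.Injective i) (x : X) (τ : I) :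
    cylinderToSuspension i (i x, τ) = Suspension.mk (x, τ) := by
  by_cases h : τ = 1
  · subst h
    rw [cylinderToSuspension_one, Suspension.mk_one]
  · have hx : i x ∈ Set.range i := ⟨x, rfl⟩
    rw [cylinderToSuspension, dif_pos ⟨h, hx⟩]
    congr 2
    exact hi (Exists.choose_spec (p := fun y => i y = i x) _)

theorem continuousOn_cylinderToSuspension {i : C(X, A)} (hi : IsClosedEmbedding i) :
    ContinuousOn (cylinderToSuspension i) {z | z.2 ≠ 1 → z.1 ∈ Set.range i} := by
  have h₁ : IsClosed {z : A × I | z.1 ∈ Set.range i} :=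
    hi.isClosed_range.preimage continuous_fst
  have h₂ : IsClosed {z : A × I | z.2 = 1} := isClosed_eq continuous_snd continuous_const
  have : {z : A × I | z.2 ≠ 1 → z.1 ∈ Set.range i} =
      {z | z.1 ∈ Set.range i} ∪ {z | z.2 = 1} := by
    ext z
    simp only [Set.mem_ofPred_eq, Set.mem_union]
    tauto
  rw [this]
  refine ContinuousOn.union_of_isClosed ?_ ?_ h₁ h₂
  · have he : IsEmbedding (Prod.map i id : X × I → A × I) :=
      hi.isEmbedding.prodMap IsEmbedding.id
    have hr : {z : A × I | z.1 ∈ Set.range i} = Set.range (Prod.map i id : X × I → A × I) := by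
      ext z; simp [Set.range_prodMap]
    rw [hr, ← Set.image_univ]
    refine he.isInducing.continuousOn_image_iff.2 ?_
    refine Continuous.continuousOn (Suspension.continuous_mk.congr fun z => ?_)
    exact (cylinderToSuspension_incl hi.injective z.1 z.2).symm
  · refine (continuousOn_const (c := Suspension.pole X true)).congr ?_
    rintro ⟨a, t⟩ (rfl : t = 1)
    exact cylinderToSuspension_one i a

namespace CollaredCollapse

variable (C : CollaredCollapse X A W)

/-- The deformation of `A` into the mapping cylinder, followed by the collapse of `A`. -/
def toSuspension : C(A × I, Suspension X) where
  toFun z := cylinderToSuspension C.incl (C.push z, C.height z)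
  continuous_toFun := by
    refine (continuousOn_cylinderToSuspension C.isClosedEmbedding).comp_continuous
      (C.push.continuous.prodMk C.height.continuous) fun z => C.push_mem z.1 z.2

theorem toSuspension_zero (a : A) : C.toSuspension (a, 0) = Suspension.pole X true := by
  simp [toSuspension, C.height_zero, cylinderToSuspension_one]

theorem toSuspension_incl (x : X) (s : I) :
    C.toSuspension (C.incl x, s) = Suspension.mk (x, σ s) := by
  simp [toSuspension, C.height_incl, C.push_incl,
    cylinderToSuspension_incl C.isClosedEmbedding.injective]

/-- A family of maps `A → Y` that are constant on `X` descends to the quotient `W`. -/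
theorem exists_descend [LocallyCompactSpace T] (g : C(T × A, Y)) (y : C(T, Y))
    (h : ∀ t x, g (t, C.incl x) = y t) :
    ∃ G : C(T × W, Y), (∀ t a, G (t, C.proj a) = g (t, a)) ∧ ∀ t, G (t, C.base) = y t := by
  let e : T × (Unit ⊕ A) → Y := fun p => Sum.elim (fun _ => y p.1) (fun a => g (p.1, a)) p.2
  have hs := C.isQuotientMap.surjective
  have key : ∀ t z z', Sum.elim (fun _ : Unit => C.base) C.proj z =
      Sum.elim (fun _ : Unit => C.base) C.proj z' → e (t, z) = e (t, z') := by
    have hb : ∀ t a, C.proj a = C.base → g (t, a) = y t := by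
      intro t a ha
      obtain ⟨x, rfl⟩ := C.mem_of_proj_eq_base a ha
      exact h t x
    rintro t (_ | a) (_ | a') hz
    · rfl
    · exact (hb t a' hz.symm).symm
    · exact hb t a hz
    · rcases C.eq_or_of_proj_eq a a' hz with rfl | ⟨⟨x, rfl⟩, ⟨x', rfl⟩⟩
      · rfl
      · exact (h t x).trans (h t x').symm
  let G : T × W → Y := fun p => e (p.1, (hs p.2).choose)
  have hG : ∀ t z, G (t, Sum.elim (fun _ : Unit => C.base) C.proj z) = e (t, z) :=
    fun t z => key t _ _ (hs _).choose_spec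
  refine ⟨⟨G, ?_⟩, fun t a => hG t (Sum.inr a), fun t => hG t (Sum.inl ())⟩
  refine C.isQuotientMap.continuous_lift_prod_right ?_
  simp only [hG]
  rw [← (Homeomorph.prodSumDistrib (X := T) (Y := Unit) (Z := A)).symm.comp_continuous_iff']
  exact continuous_sum_dom.2 ⟨y.continuous.comp continuous_fst, g.continuous⟩

variable {a₀ : A} (H : (ContinuousMap.id A).Homotopy (ContinuousMap.const A a₀))

/-- The map from the suspension of `X` to the quotient `A / X` determined by a contraction `H` of
`A`: it sends `(x, t)` to the class of the point where `H` has moved `x` at time `t`. -/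
def suspensionMap : C(Suspension X, W) where
  toFun := Suspension.lift (fun b => bif b then C.proj a₀ else C.base)
    (fun z => C.proj (H (z.2, C.incl z.1))) (by simp [C.proj_incl]) (by simp)
  continuous_toFun := Suspension.continuous_lift _ _ (by fun_prop)

theorem suspensionMap_mk (x : X) (τ : I) :
    C.suspensionMap H (Suspension.mk (x, τ)) = C.proj (H (τ, C.incl x)) := rfl

theorem suspensionMap_pole (b : Bool) :
    C.suspensionMap H (Suspension.pole X b) = bif b then C.proj a₀ else C.base := rfl

theorem suspensionMap_toSuspension (a : A) (s : I) :
    C.suspensionMap H (C.toSuspension (a, s)) = C.proj (H (C.height (a, s), C.push (a, s))) := by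
  by_cases h : C.height (a, s) = 1
  · simp [toSuspension, h, cylinderToSuspension_one, suspensionMap_pole]
  · obtain ⟨x, hx⟩ := C.push_mem a s h
    simp [toSuspension, ← hx, cylinderToSuspension_incl C.isClosedEmbedding.injective,
      suspensionMap_mk]

/-- The inverse of `suspensionMap` up to homotopy, the connecting map of the pair `(A, X)`. -/
theorem exists_connectingMap : ∃ δ : C(W, Suspension X),
    (∀ a, δ (C.proj a) = C.toSuspension (a, 1)) ∧ δ C.base = Suspension.pole X false := by
  obtain ⟨G, hG, hb⟩ := C.exists_descend (T := Unit)
    (C.toSuspension.comp ⟨fun p => (p.2, 1), by fun_prop⟩)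
    (ContinuousMap.const _ (Suspension.pole X false))
    (fun t x => by simp [toSuspension_incl, Suspension.mk_zero])
  exact ⟨G.comp ⟨fun w => ((), w), by fun_prop⟩, fun a => hG () a, hb ()⟩

/-- On the cylinder, `(x, τ)` goes to `toSuspension (H x τ, 1)`. Consider the square of points
`toSuspension (H x α, 1 - β)`. Its sides `α = 1` and `β = 1` do not depend on `x`, so the straight
path to `(1, 0)` may be moved through paths ending on these sides to the straight path to
`(0, 1)`, where one finds the identity. -/
theorem homotopic_connectingMap_comp {δ : C(W, Suspension X)}
    (hδ : ∀ a, δ (C.proj a) = C.toSuspension (a, 1)) (hb : δ C.base = Suspension.pole X false) :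
    (δ.comp (C.suspensionMap H)).Homotopic (ContinuousMap.id _) := by
  let g : I → X × I → Suspension X := fun s z =>
    C.toSuspension (H (z.2 * ramp (σ s), C.incl z.1), σ (z.2 * ramp s))
  let y : I → Bool → Suspension X := fun s b =>
    bif b then C.toSuspension (a₀, σ (ramp s)) else Suspension.pole X false
  have h₀ : ∀ s x, g s (x, 0) = y s false := by
    intro s x
    simp [g, y, toSuspension_incl, Suspension.mk_zero]
  have h₁ : ∀ s x, g s (x, 1) = y s true := by
    intro s x
    rcases ramp_symm_eq_one_or s with h | h <;> simp [g, y, h, toSuspension_zero]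
  refine ⟨⟨⟨fun p => Suspension.lift (y p.1) (g p.1) (h₀ p.1) (h₁ p.1) p.2, ?_⟩, ?_, ?_⟩⟩
  · refine Suspension.continuous_prod ?_ ?_
    · rintro (_ | _)
      · exact continuous_const
      · change Continuous fun s => C.toSuspension (a₀, σ (ramp s))
        fun_prop
    · change Continuous fun p : I × (X × I) =>
        C.toSuspension (H (p.2.2 * ramp (σ p.1), C.incl p.2.1), σ (p.2.2 * ramp p.1))
      fun_prop
  · intro z
    induction z using Suspension.ind with
    | hp b =>
      cases b
      · exact hb.symm
      · change C.toSuspension (a₀, σ (ramp 0)) = δ (C.proj a₀)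
        simp [hδ]
    | hm x τ =>
      change C.toSuspension (H (τ * ramp (σ 0), C.incl x), σ (τ * ramp 0)) =
        δ (C.proj (H (τ, C.incl x)))
      simp [hδ]
  · intro z
    induction z using Suspension.ind with
    | hp b =>
      cases b
      · rfl
      · change C.toSuspension (a₀, σ (ramp 1)) = Suspension.pole X true
        simp [toSuspension_zero]
    | hm x τ =>
      change C.toSuspension (H (τ * ramp (σ 1), C.incl x), σ (τ * ramp 1)) = Suspension.mk (x, τ)
      simp [toSuspension_incl]

/-- On the class of `a`, the composite is `proj (H (push (a, 1)) (height (a, 1)))`. Multiplying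
the time of `H` by a factor that decreases to `0` deforms it to `proj (push (a, 1))`, and running
`push` backwards deforms that to the identity. -/
theorem homotopic_comp_connectingMap {δ : C(W, Suspension X)}
    (hδ : ∀ a, δ (C.proj a) = C.toSuspension (a, 1)) (hb : δ C.base = Suspension.pole X false) :
    ((C.suspensionMap H).comp δ).Homotopic (ContinuousMap.id _) := by
  obtain ⟨G₁, hG₁, hb₁⟩ := C.exists_descend (T := I)
    ⟨fun p => C.proj (H (C.height (p.2, 1) * σ p.1, C.push (p.2, 1))), by fun_prop⟩
    (ContinuousMap.const _ C.base) (by simp [C.height_incl, C.push_incl, C.proj_incl])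
  obtain ⟨G₂, hG₂, hb₂⟩ := C.exists_descend (T := I)
    ⟨fun p => C.proj (C.push (p.2, σ p.1)), by fun_prop⟩
    (ContinuousMap.const _ C.base) (by simp [C.push_incl, C.proj_incl])
  have e₁ : ∀ w, G₁ (1, w) = G₂ (0, w) := by
    intro w
    obtain ⟨_ | a, rfl⟩ := C.isQuotientMap.surjective w
    · simp [hb₁, hb₂]
    · simp [hG₁, hG₂]
  refine ContinuousMap.Homotopic.trans (g := ⟨fun w => G₁ (1, w), by fun_prop⟩)
    ⟨⟨G₁, fun w => ?_, fun w => rfl⟩⟩ ⟨⟨G₂, fun w => (e₁ w).symm, fun w => ?_⟩⟩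
  · obtain ⟨_ | a, rfl⟩ := C.isQuotientMap.surjective w
    · exact (hb₁ 0).trans (by simp [hb, suspensionMap_pole])
    · exact (hG₁ 0 a).trans (by simp [hδ, suspensionMap_toSuspension])
  · obtain ⟨_ | a, rfl⟩ := C.isQuotientMap.surjective w
    · exact hb₂ 1
    · exact (hG₂ 1 a).trans (by simp [C.push_zero])

/-- The suspension of `X` is homotopy equivalent to `A / X`, if `A` is contractible. -/
def homotopyEquiv : ContinuousMap.HomotopyEquiv (Suspension X) W where
  toFun := C.suspensionMap H
  invFun := C.exists_connectingMap.choose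
  left_inv := C.homotopic_connectingMap_comp H C.exists_connectingMap.choose_spec.1
    C.exists_connectingMap.choose_spec.2
  right_inv := C.homotopic_comp_connectingMap H C.exists_connectingMap.choose_spec.1
    C.exists_connectingMap.choose_spec.2

/-- `suspensionMap` is natural up to pointed homotopy for all maps of pairs, although the two
contractions are unrelated: the points `H (j (H' x α)) β`, with `(α, β)` in the unit square,
interpolate between them, and do not depend on `x` if `α = 1` or `β = 1`. -/
theorem homotopicRel_suspensionMap {X' A' W' : Type*} [TopologicalSpace X'] [TopologicalSpace A']
    [TopologicalSpace W'] (C' : CollaredCollapse X' A' W') {a₀' : A'}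
    (H' : (ContinuousMap.id A').Homotopy (ContinuousMap.const A' a₀'))
    (f : C(X', X)) (j : C(A', A)) (k : C(W', W)) (hf : ∀ x, j (C'.incl x) = C.incl (f x))
    (hj : ∀ a, C.proj (j a) = k (C'.proj a)) (hk : k C'.base = C.base) :
    ContinuousMap.HomotopicRel (k.comp (C'.suspensionMap H'))
      ((C.suspensionMap H).comp (Suspension.map f)) {Suspension.base X'} := by
  let g : I → X' × I → W := fun s z =>
    C.proj (H (z.2 * ramp s, j (H' (z.2 * ramp (σ s), C'.incl z.1))))
  let y : I → Bool → W := fun s b => bif b then C.proj (H (ramp s, j a₀')) else C.base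
  have h₀ : ∀ s x, g s (x, 0) = y s false := by
    intro s x
    simp [g, y, hf, C.proj_incl]
  have h₁ : ∀ s x, g s (x, 1) = y s true := by
    intro s x
    rcases ramp_symm_eq_one_or s with h | h <;> simp [g, y, h]
  refine ⟨⟨⟨⟨fun p => Suspension.lift (y p.1) (g p.1) (h₀ p.1) (h₁ p.1) p.2, ?_⟩, ?_, ?_⟩, ?_⟩⟩
  · refine Suspension.continuous_prod ?_ ?_
    · rintro (_ | _)
      · exact continuous_const
      · change Continuous fun s => C.proj (H (ramp s, j a₀'))
        fun_prop
    · change Continuous fun p : I × (X' × I) =>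
        C.proj (H (p.2.2 * ramp p.1, j (H' (p.2.2 * ramp (σ p.1), C'.incl p.2.1))))
      fun_prop
  · intro z
    induction z using Suspension.ind with
    | hp b =>
      cases b
      · exact hk.symm
      · change C.proj (H (ramp 0, j a₀')) = k (C'.proj a₀')
        simp [hj]
    | hm x τ =>
      change C.proj (H (τ * ramp 0, j (H' (τ * ramp (σ 0), C'.incl x)))) =
        k (C'.proj (H' (τ, C'.incl x)))
      simp [hj]
  · intro z
    induction z using Suspension.ind with
    | hp b =>
      cases b
      · rfl
      · change C.proj (H (ramp 1, j a₀')) = C.proj a₀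
        simp
    | hm x τ =>
      change C.proj (H (τ * ramp 1, j (H' (τ * ramp (σ 1), C'.incl x)))) =
        C.proj (H (τ, C.incl (f x)))
      simp [hf]
  · rintro t x (rfl : x = _)
    exact hk.symm

end CollaredCollapse

end Collapse

end Fillable

end

noncomputable section

open Topology

namespace Fillable

/-! ### Wedges -/

section WedgeLemmas

variable {ι : Type*} {X : ι → Type*} [∀ i, TopologicalSpace (X i)] {p : ∀ i, X i}

open Classical in
/-- The projection of a wedge to one of its summands. -/
def Wedge.retract (i : ι) : C(Wedge X p, X i) :=
  Wedge.desc (p i) (fun j => if h : j = i then h ▸ ContinuousMap.id (X j)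
    else ContinuousMap.const _ (p i)) (fun j => by
      split_ifs with h
      · subst h; rfl
      · rfl)

theorem Wedge.retract_base (i : ι) : Wedge.retract i (Wedge.base X p) = p i := rfl

open Classical in
theorem Wedge.retract_incl_self (i : ι) (x : X i) :
    Wedge.retract i (Wedge.incl X p i x) = x := by
  change (if h : i = i then h ▸ ContinuousMap.id (X i) else ContinuousMap.const _ (p i)) x = x
  simp

open Classical in
theorem Wedge.retract_incl_of_ne {i j : ι} (h : j ≠ i) (x : X j) :
    Wedge.retract i (Wedge.incl X p j x) = p i := by
  change (dite (j = i) (fun h => h ▸ ContinuousMap.id (X j))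
    (fun _ => ContinuousMap.const _ (p i)) : C(X j, X i)) x = p i
  rw [dif_neg h]
  rfl

@[elab_as_elim]
theorem Wedge.ind {P : Wedge X p → Prop} (hb : P (Wedge.base X p))
    (hi : ∀ i x, P (Wedge.incl X p i x)) (w : Wedge X p) : P w := by
  obtain ⟨_ | ⟨i, x⟩⟩ := w
  · exact hb
  · exact hi i x

theorem Wedge.incl_eq_base_iff {i : ι} {x : X i} :
    Wedge.incl X p i x = Wedge.base X p ↔ x = p i := by
  refine ⟨fun h => ?_, fun h => h ▸ Wedge.incl_base X p i⟩
  simpa [retract_incl_self, retract_base] using congrArg (Wedge.retract i) h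

theorem Wedge.incl_injective (i : ι) : Function.Injective (Wedge.incl X p i) :=
  fun x y h => by simpa [retract_incl_self] using congrArg (Wedge.retract i) h

theorem Wedge.eq_of_incl_eq_incl {i j : ι} {x : X i} {y : X j}
    (h : Wedge.incl X p i x = Wedge.incl X p j y) (hx : x ≠ p i) : i = j := by
  by_contra hij
  apply hx
  have := congrArg (Wedge.retract i) h
  rwa [retract_incl_self, retract_incl_of_ne (Ne.symm hij)] at this

/-- The wedge injects continuously into the product of its summands. -/
instance Wedge.t2Space [∀ i, T2Space (X i)] : T2Space (Wedge X p) := by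
  refine T2Space.of_injective_continuous (f := fun (w : Wedge X p) i => Wedge.retract i w) ?_
    (continuous_pi fun i => (Wedge.retract i).continuous)
  have key : ∀ i (x : X i) w, (∀ k, Wedge.retract k (Wedge.incl X p i x) = Wedge.retract k w) →
      Wedge.incl X p i x = w := by
    intro i x w
    induction w using Wedge.ind with
    | hb =>
      intro h
      have := h i
      rw [retract_incl_self, retract_base] at this
      rw [this, incl_base]
    | hi j y =>
      intro h
      by_cases hij : i = j
      · subst hij
        have := h i
        rw [retract_incl_self, retract_incl_self] at this
        rw [this]
      · have h₁ := h i
        have h₂ := h j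
        rw [retract_incl_self, retract_incl_of_ne (Ne.symm hij)] at h₁
        rw [retract_incl_self, retract_incl_of_ne hij] at h₂
        rw [h₁, ← h₂, incl_base, incl_base]
  intro w w' h
  have h' := fun k => congrFun h k
  simp only at h'
  induction w using Wedge.ind with
  | hb =>
    induction w' using Wedge.ind with
    | hb => rfl
    | hi j y => exact (key j y _ fun k => (h' k).symm).symm
  | hi i x => exact key i x w' h'

end WedgeLemmas

/-! ### The depth of a point of a simplex -/

section Depth

variable {V : Type*}

/-- The least of the coordinates `x v`, `v ∈ s`, scaled so that it is `1` at the barycenter of `s`.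
On the face spanned by `s` it vanishes exactly on the boundary. -/
def depth (s : Finset V) (x : V → ℝ) : ℝ :=
  if h : s.Nonempty then s.card * s.inf' h x else 0

theorem continuous_depth (s : Finset V) : Continuous (depth s) := by
  by_cases h : s.Nonempty
  · have e : depth s = fun x => (s.card : ℝ) * s.inf' h x := by funext x; rw [depth, dif_pos h]
    rw [e]
    exact continuous_const.mul
      (Continuous.finset_inf'_apply h fun i _ => continuous_apply i)
  · have e : depth s = fun _ => 0 := by funext x; rw [depth, dif_neg h]
    rw [e]
    exact continuous_const

theorem depth_le {s : Finset V} (x : V → ℝ) {v : V} (hv : v ∈ s) : depth s x ≤ s.card * x v := by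
  rw [depth, dif_pos ⟨v, hv⟩]
  gcongr
  exact Finset.inf'_le x hv

theorem exists_depth_eq {s : Finset V} (hs : s.Nonempty) (x : V → ℝ) :
    ∃ v ∈ s, depth s x = s.card * x v := by
  obtain ⟨v, hv, h⟩ := s.exists_mem_eq_inf' hs x
  exact ⟨v, hv, by rw [depth, dif_pos hs, h]⟩

theorem depth_nonneg {s : Finset V} {x : V → ℝ} (h : ∀ v, 0 ≤ x v) : 0 ≤ depth s x := by
  by_cases hs : s.Nonempty
  · obtain ⟨v, -, hv⟩ := exists_depth_eq hs x
    rw [hv]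
    exact mul_nonneg (by positivity) (h v)
  · simp [depth, hs]

theorem depth_eq_zero {s : Finset V} {x : V → ℝ} (h : ∀ v, 0 ≤ x v) {v : V} (hv : v ∈ s)
    (hx : x v = 0) : depth s x = 0 :=
  le_antisymm (by simpa [hx] using depth_le x hv) (depth_nonneg h)

theorem depth_pos {s : Finset V} {x : V → ℝ} (hs : s.Nonempty) (h : ∀ v ∈ s, 0 < x v) :
    0 < depth s x := by
  obtain ⟨v, hv, e⟩ := exists_depth_eq hs x
  rw [e]
  exact mul_pos (by exact_mod_cast hs.card_pos) (h v hv)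

end Depth

/-! ### Collapsing the boundary of a simplex to a sphere -/

section SimplexToSphere

variable {n : ℕ}

/-- The squared length of `x - b` in all coordinates but the first, where `b` is the barycenter. -/
def tailSq (x : Fin (n + 1) → ℝ) : ℝ := ∑ i : Fin n, (x i.succ - 1 / (n + 1)) ^ 2

/-- The inverse stereographic projection of `(x - b) / m`, where `b` is the barycenter and `m` is
the depth of `x`, without the first coordinate of `x - b` (which is determined by the others).
The denominators are cleared, so that the formula also makes sense on the boundary, where `m`
vanishes. -/
def simplexToSphereVec (x : Fin (n + 1) → ℝ) : EuclideanSpace ℝ (Fin (n + 1)) :=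
  WithLp.toLp 2 (Fin.cons ((tailSq x - depth Finset.univ x ^ 2) /
      (tailSq x + depth Finset.univ x ^ 2))
    fun i => 2 * depth Finset.univ x * (x i.succ - 1 / (n + 1)) /
      (tailSq x + depth Finset.univ x ^ 2))

theorem tailSq_nonneg (x : Fin (n + 1) → ℝ) : 0 ≤ tailSq x :=
  Finset.sum_nonneg fun _ _ => sq_nonneg _

theorem tailSq_add_depth_sq_pos {x : Fin (n + 1) → ℝ} (hx : ∑ i, x i = 1) :
    0 < tailSq x + depth Finset.univ x ^ 2 := by
  have h₀ := tailSq_nonneg x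
  rcases h₀.lt_or_eq with h | h
  · positivity
  · -- all the other coordinates agree with the barycenter, hence so does the first one
    have h₁ : ∀ i : Fin n, x i.succ = 1 / (n + 1) := by
      intro i
      have := (Finset.sum_eq_zero_iff_of_nonneg (fun j _ => sq_nonneg _)).1 h.symm i
        (Finset.mem_univ i)
      exact sub_eq_zero.1 (pow_eq_zero_iff (two_ne_zero) |>.1 this)
    have h₂ : x 0 = 1 / (n + 1) := by
      rw [Fin.sum_univ_succ] at hx
      simp only [h₁, Finset.sum_const, Finset.card_univ, Fintype.card_fin, nsmul_eq_mul] at hx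
      rw [eq_sub_of_add_eq hx]
      field_simp
      ring
    have h₃ : ∀ i, x i = 1 / (n + 1) := Fin.cases h₂ h₁
    have h₄ : 0 < depth Finset.univ x :=
      depth_pos Finset.univ_nonempty fun i _ => by rw [h₃]; positivity
    positivity

theorem norm_simplexToSphereVec {x : Fin (n + 1) → ℝ} (hx : ∑ i, x i = 1) :
    ‖simplexToSphereVec x‖ = 1 := by
  have h := tailSq_add_depth_sq_pos hx
  have : ‖simplexToSphereVec x‖ ^ 2 = 1 := by
    rw [EuclideanSpace.real_norm_sq_eq, Fin.sum_univ_succ]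
    simp only [simplexToSphereVec, Fin.cons_zero, Fin.cons_succ, div_pow, mul_pow]
    rw [← Finset.sum_div, ← Finset.mul_sum, ← tailSq]
    field_simp
    ring
  exact (pow_eq_one_iff_of_nonneg (norm_nonneg _) two_ne_zero).1 this

theorem continuousOn_simplexToSphereVec :
    ContinuousOn (simplexToSphereVec (n := n)) (stdSimplex ℝ (Fin (n + 1))) := by
  have hd := continuous_depth (Finset.univ : Finset (Fin (n + 1)))
  have ht : Continuous (tailSq (n := n)) := by unfold tailSq; fun_prop
  have hne : ∀ x ∈ stdSimplex ℝ (Fin (n + 1)), tailSq x + depth Finset.univ x ^ 2 ≠ 0 :=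
    fun x hx => (tailSq_add_depth_sq_pos hx.2).ne'
  refine (PiLp.continuous_toLp 2 _).comp_continuousOn (continuousOn_pi.2 fun i => ?_)
  refine Fin.cases ?_ (fun i => ?_) i
  · exact ContinuousOn.div (by fun_prop) (by fun_prop) hne
  · exact ContinuousOn.div (by fun_prop) (by fun_prop) hne

open Classical in
/-- The map from the `n`-simplex to `S ^ n` that collapses the boundary to the basepoint, with
the basepoint as value outside the simplex. -/
def simplexToSphere (x : Fin (n + 1) → ℝ) : Sphere n :=
  if h : x ∈ stdSimplex ℝ (Fin (n + 1)) then
    ⟨simplexToSphereVec x, by simpa using norm_simplexToSphereVec h.2⟩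
  else Sphere.base n

theorem coe_simplexToSphere {x : Fin (n + 1) → ℝ} (h : x ∈ stdSimplex ℝ (Fin (n + 1))) :
    (simplexToSphere x : EuclideanSpace ℝ (Fin (n + 1))) = simplexToSphereVec x := by
  simp [simplexToSphere, h]

theorem continuousOn_simplexToSphere :
    ContinuousOn (simplexToSphere (n := n)) (stdSimplex ℝ (Fin (n + 1))) := by
  rw [Topology.IsInducing.subtypeVal.continuousOn_iff]
  exact continuousOn_simplexToSphereVec.congr fun x hx => coe_simplexToSphere hx

theorem simplexToSphere_of_eq_zero {x : Fin (n + 1) → ℝ} (h : x ∈ stdSimplex ℝ (Fin (n + 1)))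
    {i : Fin (n + 1)} (hi : x i = 0) : simplexToSphere x = Sphere.base n := by
  have hd : depth Finset.univ x = 0 := depth_eq_zero h.1 (Finset.mem_univ i) hi
  have hp := tailSq_add_depth_sq_pos h.2
  rw [hd] at hp
  ext i
  rw [coe_simplexToSphere h, simplexToSphereVec, hd]
  have hne : tailSq x ≠ 0 := by
    intro h0
    simp [h0] at hp
  refine Fin.cases ?_ (fun i => ?_) i
  · simp [Sphere.base, hne]
  · simp [Sphere.base]

theorem simplexToSphere_ne_base {x : Fin (n + 1) → ℝ} (h : x ∈ stdSimplex ℝ (Fin (n + 1)))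
    (hx : ∀ i, 0 < x i) : simplexToSphere x ≠ Sphere.base n := by
  intro e
  have hp := tailSq_add_depth_sq_pos h.2
  have hd : 0 < depth Finset.univ x := depth_pos Finset.univ_nonempty fun i _ => hx i
  have e₀ := congrArg (fun P : Sphere n => (P : EuclideanSpace ℝ (Fin (n + 1))) 0) e
  simp only [coe_simplexToSphere h, simplexToSphereVec, Sphere.base, Fin.cons_zero,
    PiLp.single_apply, if_true] at e₀
  rw [div_eq_one_iff_eq hp.ne'] at e₀
  have : 0 < depth Finset.univ x ^ 2 := by positivity
  linarith

/-- The depth of a point `b + m w`, with `b` the barycenter, determines `m`. -/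
theorem depth_univ_le_of_ray {x y w : Fin (n + 1) → ℝ}
    (hx₀ : 0 < depth Finset.univ x)
    (hx : ∀ i, x i = 1 / (n + 1) + depth Finset.univ x * w i)
    (hy : ∀ i, y i = 1 / (n + 1) + depth Finset.univ y * w i) :
    depth Finset.univ y ≤ depth Finset.univ x := by
  obtain ⟨i, -, hi⟩ := exists_depth_eq Finset.univ_nonempty x
  have hj := depth_le y (Finset.mem_univ i)
  rw [hx i] at hi
  rw [hy i] at hj
  simp only [Finset.card_univ, Fintype.card_fin, Nat.cast_add, Nat.cast_one] at hi hj
  set m := depth Finset.univ x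
  set m' := depth Finset.univ y
  have hn : ((n : ℝ) + 1) * (1 / (n + 1)) = 1 := by field_simp
  have h₁ : m * (1 - (n + 1) * w i) = 1 := by linear_combination hi + hn
  have h₂ : m' * (1 - (n + 1) * w i) ≤ 1 := by nlinarith
  have h₃ : 0 < 1 - (n + 1) * w i := by
    by_contra hneg
    nlinarith
  exact le_of_mul_le_mul_right (h₂.trans h₁.ge) h₃

theorem simplexToSphere_injOn {x y : Fin (n + 1) → ℝ} (hx : x ∈ stdSimplex ℝ (Fin (n + 1)))
    (hy : y ∈ stdSimplex ℝ (Fin (n + 1))) (hx₀ : ∀ i, 0 < x i) (hy₀ : ∀ i, 0 < y i)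
    (h : simplexToSphere x = simplexToSphere y) : x = y := by
  have hpx := tailSq_add_depth_sq_pos hx.2
  have hpy := tailSq_add_depth_sq_pos hy.2
  have hdx : 0 < depth Finset.univ x := depth_pos Finset.univ_nonempty fun i _ => hx₀ i
  have hdy : 0 < depth Finset.univ y := depth_pos Finset.univ_nonempty fun i _ => hy₀ i
  have e : ∀ i, simplexToSphereVec x i = simplexToSphereVec y i := by
    intro i
    rw [← coe_simplexToSphere hx, ← coe_simplexToSphere hy, h]
  have e₀ := e 0
  simp only [simplexToSphereVec, Fin.cons_zero] at e₀
  -- the points `(x - b) / depth x` and `(y - b) / depth y` agree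
  have e₁ : ∀ i : Fin n, (x i.succ - 1 / (n + 1)) / depth Finset.univ x =
      (y i.succ - 1 / (n + 1)) / depth Finset.univ y := by
    intro i
    have ei := e i.succ
    simp only [simplexToSphereVec, Fin.cons_succ] at ei
    generalize x i.succ - 1 / ((n : ℝ) + 1) = u at ei ⊢
    generalize y i.succ - 1 / ((n : ℝ) + 1) = u' at ei ⊢
    generalize depth Finset.univ x = m at *
    generalize depth Finset.univ y = m' at *
    generalize tailSq x = N at *
    generalize tailSq y = N' at *
    rw [div_eq_div_iff hpx.ne' hpy.ne'] at e₀ ei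
    rw [div_eq_div_iff hdx.ne' hdy.ne']
    have h₁ : m ^ 2 * (N' + m' ^ 2) = m' ^ 2 * (N + m ^ 2) := by linear_combination -e₀ / 2
    have h₂ : (m * (N' + m' ^ 2)) * (u * m') = (m * (N' + m' ^ 2)) * (u' * m) := by
      linear_combination m' / 2 * ei - u' * h₁
    exact mul_left_cancel₀ (mul_pos hdx hpy).ne' h₂
  have hsum : ∀ z : Fin (n + 1) → ℝ, ∑ i, z i = 1 →
      z 0 - 1 / (n + 1) = -∑ i : Fin n, (z i.succ - 1 / (n + 1)) := by
    intro z hz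
    rw [Fin.sum_univ_succ] at hz
    rw [Finset.sum_sub_distrib, Finset.sum_const, Finset.card_univ, Fintype.card_fin,
      nsmul_eq_mul]
    have hn : ((n : ℝ) + 1) * (1 / (n + 1)) = 1 := by field_simp
    linear_combination hz - hn
  have e₂ : ∀ i, (x i - 1 / (n + 1)) / depth Finset.univ x =
      (y i - 1 / (n + 1)) / depth Finset.univ y := by
    refine Fin.cases ?_ e₁
    rw [hsum x hx.2, hsum y hy.2, neg_div, neg_div, Finset.sum_div, Finset.sum_div]
    simp only [e₁]
  have hxw : ∀ i, x i = 1 / (n + 1) +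
      depth Finset.univ x * ((x i - 1 / (n + 1)) / depth Finset.univ x) := by
    intro i; rw [mul_div_cancel₀ _ hdx.ne']; ring
  have hyw : ∀ i, y i = 1 / (n + 1) +
      depth Finset.univ y * ((x i - 1 / (n + 1)) / depth Finset.univ x) := by
    intro i; rw [e₂ i, mul_div_cancel₀ _ hdy.ne']; ring
  have hd : depth Finset.univ x = depth Finset.univ y :=
    le_antisymm (depth_univ_le_of_ray hdy hyw hxw) (depth_univ_le_of_ray hdx hxw hyw)
  funext i
  rw [hxw i, hyw i, hd]

theorem exists_simplexToSphere_eq {P : Sphere n} (hP : P ≠ Sphere.base n) :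
    ∃ x ∈ stdSimplex ℝ (Fin (n + 1)), (∀ i, 0 < x i) ∧ simplexToSphere x = P := by
  obtain ⟨P, hPn⟩ := P
  have hsq : P 0 ^ 2 + ∑ i : Fin n, P i.succ ^ 2 = 1 := by
    have h : ‖P‖ = 1 := by simpa using hPn
    rw [← Fin.sum_univ_succ (fun i => P i ^ 2), ← EuclideanSpace.real_norm_sq_eq, h, one_pow]
  have h₁ : P 0 < 1 := by
    have hs : 0 ≤ ∑ i : Fin n, P i.succ ^ 2 := Finset.sum_nonneg fun _ _ => sq_nonneg _
    have hle : P 0 ≤ 1 := by nlinarith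
    refine hle.lt_of_ne fun h => hP ?_
    have hz : ∑ i : Fin n, P i.succ ^ 2 = 0 := by rw [h] at hsq; linarith
    ext i
    refine Fin.cases ?_ (fun i => ?_) i
    · simp [Sphere.base, h]
    · have := (Finset.sum_eq_zero_iff_of_nonneg (fun j _ => sq_nonneg _)).1 hz i
        (Finset.mem_univ i)
      simpa [Sphere.base] using this
  have hq : 0 < 1 - P 0 := by linarith
  -- the stereographic projection of `P`, with the coordinate that makes the sum vanish
  let w : Fin (n + 1) → ℝ := Fin.cons (-∑ i : Fin n, P i.succ / (1 - P 0))
    fun i => P i.succ / (1 - P 0)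
  have hw : ∑ i, w i = 0 := by simp [w, Fin.sum_univ_succ]
  obtain ⟨j, -, hj⟩ := Finset.exists_min_image Finset.univ w Finset.univ_nonempty
  have hwj : w j ≤ 0 := by
    by_contra hneg
    push Not at hneg
    have : 0 < ∑ i, w i :=
      Finset.sum_pos (fun i hi => hneg.trans_le (hj i hi)) Finset.univ_nonempty
    linarith
  -- the depth of the preimage
  let m : ℝ := 1 / (1 - (n + 1) * w j)
  have hden : 0 < 1 - ((n : ℝ) + 1) * w j := by
    have : 0 ≤ (n : ℝ) + 1 := by positivity
    nlinarith
  have hm : 0 < m := by positivity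
  have hmj : m * (1 - ((n : ℝ) + 1) * w j) = 1 := by simp only [m]; field_simp
  have hn : ((n : ℝ) + 1) * (1 / (n + 1)) = 1 := by field_simp
  have hn₀ : 0 < (n : ℝ) + 1 := by positivity
  let x : Fin (n + 1) → ℝ := fun i => 1 / (n + 1) + m * w i
  have hxj : ((n : ℝ) + 1) * x j = m := by
    simp only [x]
    linear_combination hn - hmj
  have hxle : ∀ i, x j ≤ x i := by
    intro i
    have := hj i (Finset.mem_univ i)
    simp only [x]
    gcongr
  have hx₀ : ∀ i, 0 < x i := by
    intro i
    refine lt_of_lt_of_le ?_ (hxle i)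
    by_contra hneg
    nlinarith
  have hd : depth Finset.univ x = m := by
    refine le_antisymm ?_ ?_
    · have := depth_le x (Finset.mem_univ j)
      simpa [hxj] using this
    · obtain ⟨i, -, hi⟩ := exists_depth_eq Finset.univ_nonempty x
      rw [hi, ← hxj]
      simp only [Finset.card_univ, Fintype.card_fin, Nat.cast_add, Nat.cast_one]
      have := hxle i
      gcongr
  have hxs : x ∈ stdSimplex ℝ (Fin (n + 1)) := by
    refine ⟨fun i => (hx₀ i).le, ?_⟩
    simp only [x, Finset.sum_add_distrib, ← Finset.mul_sum, hw, Finset.sum_const,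
      Finset.card_univ, Fintype.card_fin, nsmul_eq_mul, Nat.cast_add, Nat.cast_one]
    linear_combination hn
  have hxw : ∀ i : Fin n, x i.succ - 1 / (n + 1) = m * (P i.succ / (1 - P 0)) := by
    intro i; simp [x, w]
  have ht : tailSq x * (1 - P 0) = m ^ 2 * (1 + P 0) := by
    have : tailSq x = m ^ 2 * ((∑ i : Fin n, P i.succ ^ 2) / (1 - P 0) ^ 2) := by
      simp only [tailSq, hxw, mul_pow, div_pow, ← Finset.mul_sum, ← Finset.sum_div]
    rw [this, eq_sub_of_add_eq' hsq]
    field_simp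
    ring
  have ht' : tailSq x = m ^ 2 * (1 + P 0) / (1 - P 0) := by
    rw [eq_div_iff hq.ne', ht]
  refine ⟨x, hxs, hx₀, ?_⟩
  ext i
  rw [coe_simplexToSphere hxs]
  refine Fin.cases ?_ (fun i => ?_) i
  · simp only [simplexToSphereVec, Fin.cons_zero, hd, ht']
    field_simp
    ring
  · simp only [simplexToSphereVec, Fin.cons_succ, hd, ht', hxw]
    field_simp
    ring

end SimplexToSphere

end Fillable

end

noncomputable section

open Topology

namespace Fillable

/-! ### Realizations -/

section Realization

variable {V : Type*} [Fintype V]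

open Classical in
/-- The set of the vertices at which a barycentric coordinate of `x` is non-zero. -/
def supp (x : V → ℝ) : Finset V := Finset.univ.filter fun v => x v ≠ 0

theorem mem_supp {x : V → ℝ} {v : V} : v ∈ supp x ↔ x v ≠ 0 := by simp [supp]

theorem supp_subset_iff {x : V → ℝ} {s : Finset V} : supp x ⊆ s ↔ ∀ v, v ∉ s → x v = 0 := by
  refine forall_congr' fun v => ?_
  rw [mem_supp]
  tauto

theorem supp_nonempty {x : V → ℝ} (hx : x ∈ stdSimplex ℝ V) : (supp x).Nonempty := by
  by_contra h
  rw [Finset.not_nonempty_iff_eq_empty] at h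
  have h0 : ∀ v, x v = 0 := fun v => supp_subset_iff.1 h.le v (Finset.notMem_empty v)
  simpa [h0] using hx.2

theorem pos_of_mem_supp {x : V → ℝ} (hx : x ∈ stdSimplex ℝ V) {v : V} (hv : v ∈ supp x) :
    0 < x v :=
  (hx.1 v).lt_of_ne (mem_supp.1 hv).symm

theorem mem_realization_iff {K : PreAbstractSimplicialComplex V} {x : V → ℝ} :
    x ∈ realization K ↔ x ∈ stdSimplex ℝ V ∧ supp x ∈ K.faces := by
  refine and_congr_right fun hx => ⟨?_, fun h => ⟨_, h, supp_subset_iff.1 subset_rfl⟩⟩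
  rintro ⟨s, hs, h⟩
  exact (K.isRelLowerSet_faces hs).2 (supp_subset_iff.2 h) (supp_nonempty hx)

/-- The face of the standard simplex on `V` that is spanned by `s`. -/
def closedFace (s : Finset V) : Set (V → ℝ) := {x | x ∈ stdSimplex ℝ V ∧ ∀ v, v ∉ s → x v = 0}

theorem isClosed_closedFace (s : Finset V) : IsClosed (closedFace s) := by
  have h : IsClosed {x : V → ℝ | ∀ v, v ∉ s → x v = 0} := by
    simp only [Set.ofPred_forall]
    exact isClosed_iInter fun v => isClosed_iInter fun _ =>
      isClosed_eq (continuous_apply v) continuous_const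
  exact (isClosed_stdSimplex ℝ V).inter h

theorem realization_eq_biUnion (K : PreAbstractSimplicialComplex V) :
    realization K = ⋃ s ∈ K.faces, closedFace s := by
  ext x
  simp only [realization, closedFace, Set.mem_iUnion, Set.mem_ofPred_eq]
  constructor
  · rintro ⟨hx, s, hs, h⟩
    exact ⟨s, hs, hx, h⟩
  · rintro ⟨s, hs, hx, h⟩
    exact ⟨hx, s, hs, h⟩

instance (K : PreAbstractSimplicialComplex V) : CompactSpace (realization K) := by
  rw [← isCompact_iff_compactSpace]
  refine (isCompact_stdSimplex ℝ V).of_isClosed_subset ?_ fun x hx => hx.1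
  rw [realization_eq_biUnion]
  exact (Set.toFinite _).isClosed_biUnion fun s _ => isClosed_closedFace s

theorem isClosedEmbedding_realizationIncl {L K : PreAbstractSimplicialComplex V} (h : L ≤ K) :
    IsClosedEmbedding (realizationIncl h) :=
  (realizationIncl h).continuous.isClosedEmbedding (Set.inclusion_injective (realization_mono h))

end Realization

/-! ### Collapsing the boundary of a face to a sphere -/

section FaceToSphere

variable {V : Type*} {σ : Finset V}

/-- A numbering of the vertices of a non-empty simplex. -/
def vertexEquiv (hσ : σ.Nonempty) : Fin (σ.card - 1 + 1) ≃ σ :=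
  (finCongr (Nat.succ_pred_eq_of_pos hσ.card_pos)).trans σ.equivFin.symm

/-- The map from the face spanned by `σ` to the sphere `S ^ (|σ| - 1)` that collapses the boundary
of the face to the basepoint. -/
def faceToSphere (hσ : σ.Nonempty) (x : V → ℝ) : Sphere (σ.card - 1) :=
  simplexToSphere fun i => x (vertexEquiv hσ i)

variable [Fintype V]

theorem sum_vertexEquiv (hσ : σ.Nonempty) {x : V → ℝ} (h : ∀ v, v ∉ σ → x v = 0) :
    ∑ i, x (vertexEquiv hσ i) = ∑ v, x v := by
  rw [(vertexEquiv hσ).sum_comp (fun v : σ => x v), Finset.sum_coe_sort σ x]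
  exact Finset.sum_subset (Finset.subset_univ σ) fun v _ hv => h v hv

theorem comp_vertexEquiv_mem (hσ : σ.Nonempty) {x : V → ℝ} (hx : x ∈ closedFace σ) :
    (fun i => x (vertexEquiv hσ i)) ∈ stdSimplex ℝ (Fin (σ.card - 1 + 1)) :=
  ⟨fun _ => hx.1.1 _, (sum_vertexEquiv hσ hx.2).trans hx.1.2⟩

theorem continuousOn_faceToSphere (hσ : σ.Nonempty) :
    ContinuousOn (faceToSphere hσ) (closedFace σ) :=
  continuousOn_simplexToSphere.comp
    (continuous_pi fun _ => continuous_apply _).continuousOn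
    fun _ hx => comp_vertexEquiv_mem hσ hx

theorem faceToSphere_of_eq_zero (hσ : σ.Nonempty) {x : V → ℝ} (hx : x ∈ closedFace σ) {v : V}
    (hv : v ∈ σ) (h : x v = 0) : faceToSphere hσ x = Sphere.base _ :=
  simplexToSphere_of_eq_zero (comp_vertexEquiv_mem hσ hx)
    (i := (vertexEquiv hσ).symm ⟨v, hv⟩) (by simpa using h)

theorem faceToSphere_ne_base (hσ : σ.Nonempty) {x : V → ℝ} (hx : x ∈ closedFace σ)
    (h : ∀ v ∈ σ, 0 < x v) : faceToSphere hσ x ≠ Sphere.base _ :=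
  simplexToSphere_ne_base (comp_vertexEquiv_mem hσ hx) fun i => h _ (vertexEquiv hσ i).2

theorem faceToSphere_injOn (hσ : σ.Nonempty) {x y : V → ℝ} (hx : x ∈ closedFace σ)
    (hy : y ∈ closedFace σ) (hx₀ : ∀ v ∈ σ, 0 < x v) (hy₀ : ∀ v ∈ σ, 0 < y v)
    (h : faceToSphere hσ x = faceToSphere hσ y) : x = y := by
  have e := simplexToSphere_injOn (comp_vertexEquiv_mem hσ hx) (comp_vertexEquiv_mem hσ hy)
    (fun i => hx₀ _ (vertexEquiv hσ i).2) (fun i => hy₀ _ (vertexEquiv hσ i).2) h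
  funext v
  by_cases hv : v ∈ σ
  · simpa using congrFun e ((vertexEquiv hσ).symm ⟨v, hv⟩)
  · rw [hx.2 v hv, hy.2 v hv]

theorem exists_faceToSphere_eq (hσ : σ.Nonempty) {P : Sphere (σ.card - 1)}
    (hP : P ≠ Sphere.base _) :
    ∃ x ∈ closedFace σ, (∀ v ∈ σ, 0 < x v) ∧ faceToSphere hσ x = P := by
  classical
  obtain ⟨y, hy, hy₀, e⟩ := exists_simplexToSphere_eq hP
  let x : V → ℝ := fun v => if h : v ∈ σ then y ((vertexEquiv hσ).symm ⟨v, h⟩) else 0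
  have hxy : (fun i => x (vertexEquiv hσ i)) = y := by
    funext i
    simp [x]
  have hx₀ : ∀ v ∈ σ, 0 < x v := by
    intro v hv
    simp only [x, dif_pos hv]
    exact hy₀ _
  have hx : ∀ v, v ∉ σ → x v = 0 := by
    intro v hv
    simp [x, hv]
  refine ⟨x, ⟨⟨fun v => ?_, ?_⟩, hx⟩, hx₀, ?_⟩
  · by_cases hv : v ∈ σ
    · exact (hx₀ v hv).le
    · exact (hx v hv).ge
  · rw [← sum_vertexEquiv hσ hx, ← hy.2]
    exact congrArg (fun z : Fin (σ.card - 1 + 1) → ℝ => ∑ i, z i) hxy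
  · rw [faceToSphere, hxy, e]

end FaceToSphere

/-! ### Collapsing a complex to a wedge of spheres -/

section CollapseToWedge

variable {V : Type*} {K : PreAbstractSimplicialComplex V} {F : Set (Finset V)}

theorem le_addFaces (hF : ∀ σ ∈ F, IsMinimalNonface K σ) : K ≤ addFaces K F hF :=
  fun _ hs => Or.inl hs

/-- A minimal non-face is not a simplex, so no simplex of `K` contains it, and distinct minimal
non-faces are not nested. -/
theorem eq_of_subset_of_mem (hF : ∀ σ ∈ F, IsMinimalNonface K σ) {σ s : Finset V} (hσ : σ ∈ F)
    (hs : s ∈ (addFaces K F hF).faces) (h : σ ⊆ s) : s = σ := by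
  by_contra hne
  refine (hF σ hσ).2.1 ?_
  rcases hs with hs | hs
  · exact (K.isRelLowerSet_faces hs).2 h (hF σ hσ).1
  · exact (hF s hs).2.2 σ (h.ssubset_of_ne (Ne.symm hne)) (hF σ hσ).1

variable [Fintype V]

theorem exists_eq_zero (hF : ∀ σ ∈ F, IsMinimalNonface K σ) {x : V → ℝ}
    (hx : x ∈ realization (addFaces K F hF)) {σ : Finset V} (hσ : σ ∈ F) (h : supp x ≠ σ) :
    ∃ v ∈ σ, x v = 0 := by
  by_contra! hne
  exact h (eq_of_subset_of_mem hF hσ (mem_realization_iff.1 hx).2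
    fun v hv => mem_supp.2 (hne v hv))

theorem mem_realization_of_supp_notMem (hF : ∀ σ ∈ F, IsMinimalNonface K σ) {x : V → ℝ}
    (hx : x ∈ realization (addFaces K F hF)) (h : supp x ∉ F) : x ∈ realization K := by
  have := mem_realization_iff.1 hx
  exact mem_realization_iff.2 ⟨this.1, this.2.resolve_right h⟩

theorem supp_notMem (hF : ∀ σ ∈ F, IsMinimalNonface K σ) {x : V → ℝ}
    (hx : x ∈ realization K) : supp x ∉ F :=
  fun h => (hF _ h).2.1 (mem_realization_iff.1 hx).2

/-- The inclusion of the summand of `σ` into a wedge of spheres. -/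
abbrev SphereWedge.incl {σ : Finset V} (hσ : σ ∈ F) : C(Sphere (σ.card - 1), SphereWedge F) :=
  Wedge.incl (fun σ : F => Sphere (σ.1.card - 1)) (fun σ => Sphere.base (σ.1.card - 1)) ⟨σ, hσ⟩

open Classical in
/-- The map that collapses `K` and the boundaries of the added faces: a point whose support is an
added face goes to the sphere of this face. -/
def collapse (hF : ∀ σ ∈ F, IsMinimalNonface K σ) (x : V → ℝ) : SphereWedge F :=
  if h : supp x ∈ F then SphereWedge.incl h (faceToSphere (hF _ h).1 x) else SphereWedge.base F

theorem collapse_of_supp_eq (hF : ∀ σ ∈ F, IsMinimalNonface K σ) {x : V → ℝ} {σ : Finset V}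
    (hσ : σ ∈ F) (h : supp x = σ) :
    collapse hF x = SphereWedge.incl hσ (faceToSphere (hF σ hσ).1 x) := by
  subst h
  rw [collapse, dif_pos hσ]

theorem collapse_of_notMem (hF : ∀ σ ∈ F, IsMinimalNonface K σ) {x : V → ℝ} (h : supp x ∉ F) :
    collapse hF x = SphereWedge.base F := by
  rw [collapse, dif_neg h]

theorem continuousOn_collapse (hF : ∀ σ ∈ F, IsMinimalNonface K σ) :
    ContinuousOn (collapse hF) (realization (addFaces K F hF)) := by
  have hA : realization (addFaces K F hF) =
      ⋃ s : (addFaces K F hF).faces, closedFace s.1 := by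
    rw [realization_eq_biUnion, Set.biUnion_eq_iUnion]
  rw [hA]
  refine (locallyFinite_of_finite _).continuousOn_iUnion (fun s => isClosed_closedFace s.1) ?_
  rintro ⟨s, hs⟩
  have hmem : ∀ x ∈ closedFace s, x ∈ realization (addFaces K F hF) :=
    fun x hx => ⟨hx.1, s, hs, hx.2⟩
  by_cases hsF : s ∈ F
  · refine ((SphereWedge.incl hsF).continuous.comp_continuousOn
      (continuousOn_faceToSphere (hF s hsF).1)).congr fun x hx => ?_
    by_cases h : supp x = s
    · exact collapse_of_supp_eq hF hsF h
    · obtain ⟨v, hv, hv0⟩ := exists_eq_zero hF (hmem x hx) hsF h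
      have hx' : supp x ∉ F := by
        intro hx'
        exact h (eq_of_subset_of_mem hF hx' hs (supp_subset_iff.2 hx.2)).symm
      rw [collapse_of_notMem hF hx', Function.comp_apply,
        faceToSphere_of_eq_zero (hF s hsF).1 hx hv hv0]
      exact (Wedge.incl_base _ _ _).symm
  · refine (continuousOn_const (c := SphereWedge.base F)).congr fun x hx => ?_
    refine collapse_of_notMem hF fun hx' => hsF ?_
    rwa [eq_of_subset_of_mem hF hx' hs (supp_subset_iff.2 hx.2)]

theorem mem_closedFace_supp {x : V → ℝ} {σ : Finset V} (hx : x ∈ stdSimplex ℝ V)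
    (h : supp x = σ) : x ∈ closedFace σ :=
  ⟨hx, supp_subset_iff.1 h.le⟩

theorem collapse_ne_base (hF : ∀ σ ∈ F, IsMinimalNonface K σ) {x : V → ℝ}
    (hx : x ∈ stdSimplex ℝ V) (h : supp x ∈ F) : collapse hF x ≠ SphereWedge.base F := by
  rw [collapse_of_supp_eq hF h rfl, Ne, Wedge.incl_eq_base_iff]
  exact faceToSphere_ne_base _ (mem_closedFace_supp hx rfl) fun v hv => pos_of_mem_supp hx hv

theorem collapse_injOn (hF : ∀ σ ∈ F, IsMinimalNonface K σ) {x y : V → ℝ}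
    (hx : x ∈ stdSimplex ℝ V) (hy : y ∈ stdSimplex ℝ V) (h : supp x ∈ F)
    (e : collapse hF x = collapse hF y) : x = y := by
  have hy' : supp y ∈ F := by
    by_contra hy'
    exact collapse_ne_base hF hx h (e.trans (collapse_of_notMem hF hy'))
  have hxb := faceToSphere_ne_base (hF _ h).1 (mem_closedFace_supp hx rfl)
    fun v hv => pos_of_mem_supp hx hv
  have hs : supp x = supp y := by
    rw [collapse_of_supp_eq hF h rfl, collapse_of_supp_eq hF hy' rfl] at e
    exact congrArg Subtype.val (Wedge.eq_of_incl_eq_incl e hxb)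
  rw [collapse_of_supp_eq hF h rfl, collapse_of_supp_eq hF h hs.symm] at e
  exact faceToSphere_injOn _ (mem_closedFace_supp hx rfl) (mem_closedFace_supp hy hs.symm)
    (fun v hv => pos_of_mem_supp hx hv) (fun v hv => pos_of_mem_supp hy (hs ▸ hv))
    (Wedge.incl_injective (X := fun σ : F => Sphere (σ.1.card - 1)) ⟨supp x, h⟩ e)

/-- The map `collapse` on the realization. -/
def collapseMap (hF : ∀ σ ∈ F, IsMinimalNonface K σ) :
    C(realization (addFaces K F hF), SphereWedge F) where
  toFun x := collapse hF x.1
  continuous_toFun := continuousOn_iff_continuous_domRestrict.1 (continuousOn_collapse hF)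

theorem isQuotientMap_collapse (hF : ∀ σ ∈ F, IsMinimalNonface K σ) :
    IsQuotientMap (Sum.elim (fun _ : Unit => SphereWedge.base F) (collapseMap hF)) := by
  refine IsQuotientMap.of_surjective_continuous ?_
    (continuous_const.sumElim (collapseMap hF).continuous)
  intro w
  induction w using Wedge.ind with
  | hb => exact ⟨Sum.inl (), rfl⟩
  | hi σ P =>
    obtain ⟨σ, hσ⟩ := σ
    by_cases hP : P = Sphere.base _
    · subst hP
      exact ⟨Sum.inl (), (Wedge.incl_base (fun σ : F => Sphere (σ.1.card - 1))
        (fun σ => Sphere.base (σ.1.card - 1)) ⟨σ, hσ⟩).symm⟩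
    · obtain ⟨x, hx, hx₀, e⟩ := exists_faceToSphere_eq (hF σ hσ).1 hP
      refine ⟨Sum.inr ⟨x, hx.1, σ, Or.inr hσ, hx.2⟩, ?_⟩
      have hs : supp x = σ := (supp_subset_iff.2 hx.2).antisymm
        fun v hv => mem_supp.2 (hx₀ v hv).ne'
      change collapse hF x = _
      rw [collapse_of_supp_eq hF hσ hs, e]

/-- The collapses are strictly natural: a face added to `L` is either added to `K` as well, or
already a simplex of `K`. -/
theorem collapse_naturality {L : PreAbstractSimplicialComplex V} {G : Set (Finset V)}
    (hF : ∀ σ ∈ F, IsMinimalNonface K σ) (hG : ∀ σ ∈ G, IsMinimalNonface L σ) (hLK : L ≤ K)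
    {x : V → ℝ} (hx : x ∈ realization (addFaces L G hG)) :
    collapse hF x = SphereWedge.map G F (collapse hG x) := by
  classical
  by_cases h : supp x ∈ G
  · rw [collapse_of_supp_eq hG h rfl]
    change _ = (dite (supp x ∈ F) (fun h => SphereWedge.incl h)
      (fun _ => ContinuousMap.const _ (SphereWedge.base F)) : C(_, SphereWedge F)) _
    split_ifs with h'
    · exact collapse_of_supp_eq hF h' rfl
    · exact collapse_of_notMem hF h'
  · rw [collapse_of_notMem hG h, collapse_of_notMem hF]
    · rfl
    · exact supp_notMem hF (realization_mono hLK (mem_realization_of_supp_notMem hG hx h))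

end CollapseToWedge

/-! ### Stretching the added faces over a collar -/

section Stretch

variable {V : Type*}

/-- The factor by which a point of depth `m` is moved away from the barycenter at time `s`. It is
`1 + s`, or less if the point would leave the face: in that case `1 / (1 - m)`, which moves the
point to the boundary. -/
def stretchFactor (m s : ℝ) : ℝ := (max (1 - m) (1 + s)⁻¹)⁻¹

theorem stretchFactor_zero_left {s : ℝ} (hs : 0 ≤ s) : stretchFactor 0 s = 1 := by
  have : (1 + s)⁻¹ ≤ 1 := inv_le_one_of_one_le₀ (by linarith)
  simp [stretchFactor, this]

theorem stretchFactor_zero_right {m : ℝ} (hm : 0 ≤ m) : stretchFactor m 0 = 1 := by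
  simp [stretchFactor, hm]

theorem stretchFactor_pos {m s : ℝ} (hs : 0 ≤ s) : 0 < stretchFactor m s :=
  inv_pos.2 (lt_max_of_lt_right (by positivity))

theorem stretchFactor_mul_le {m s : ℝ} (hs : 0 ≤ s) : stretchFactor m s * (1 - m) ≤ 1 := by
  have h : 0 < max (1 - m) (1 + s)⁻¹ := lt_max_of_lt_right (by positivity)
  rw [stretchFactor, inv_mul_le_one₀ h]
  exact le_max_left _ _

theorem stretchFactor_mul_eq {m s : ℝ} (hs : 0 ≤ s) (h : (1 + s) * m < s) :
    stretchFactor m s * (1 - m) = 1 := by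
  have h₁ : (1 + s)⁻¹ ≤ 1 - m := by
    rw [inv_le_iff_one_le_mul₀ (by linarith)]
    nlinarith
  have h₂ : 0 < 1 - m := lt_of_lt_of_le (by positivity) h₁
  rw [stretchFactor, max_eq_left h₁, inv_mul_cancel₀ h₂.ne']

variable [Fintype V]

open Classical in
/-- The barycenter of the face spanned by `σ`. -/
def barycenter (σ : Finset V) (v : V) : ℝ := if v ∈ σ then 1 / σ.card else 0

theorem sum_barycenter {σ : Finset V} (hσ : σ.Nonempty) : ∑ v, barycenter σ v = 1 := by
  classical
  have : (σ.card : ℝ) ≠ 0 := by exact_mod_cast hσ.card_pos.ne'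
  simp [barycenter, Finset.sum_ite_mem, this]

variable {K : PreAbstractSimplicialComplex V} {F : Set (Finset V)}

open Classical in
/-- The map that expands each face `σ ∈ F` from its barycenter by the factor `stretchFactor`. On
each point of the realization at most one summand is non-zero. -/
def stretch (F : Set (Finset V)) (x : V → ℝ) (s : ℝ) : V → ℝ :=
  x + ∑ σ ∈ (Set.toFinite F).toFinset, (stretchFactor (depth σ x) s - 1) • (x - barycenter σ)

/-- The height in the collar to which a point is moved at time `s`. -/
def stretchHeight (F : Set (Finset V)) (x : V → ℝ) (s : ℝ) : ℝ :=
  min 1 (1 - s + (1 + s) * ∑ σ ∈ (Set.toFinite F).toFinset, depth σ x)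

theorem depth_eq_zero_of_supp_ne (hF : ∀ σ ∈ F, IsMinimalNonface K σ) {x : V → ℝ}
    (hx : x ∈ realization (addFaces K F hF)) {σ : Finset V} (hσ : σ ∈ F) (h : supp x ≠ σ) :
    depth σ x = 0 := by
  obtain ⟨v, hv, h0⟩ := exists_eq_zero hF hx hσ h
  exact depth_eq_zero hx.1.1 hv h0

theorem stretch_of_supp_eq (hF : ∀ σ ∈ F, IsMinimalNonface K σ) {x : V → ℝ}
    (hx : x ∈ realization (addFaces K F hF)) {σ : Finset V} (hσ : σ ∈ F) (h : supp x = σ)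
    {s : ℝ} (hs : 0 ≤ s) :
    stretch F x s = x + (stretchFactor (depth σ x) s - 1) • (x - barycenter σ) := by
  rw [stretch, Finset.sum_eq_single σ]
  · intro τ hτ hne
    rw [depth_eq_zero_of_supp_ne hF hx ((Set.Finite.mem_toFinset _).1 hτ) (h.trans_ne hne.symm),
      stretchFactor_zero_left hs]
    simp
  · intro h'
    exact absurd ((Set.Finite.mem_toFinset _).2 hσ) h'

theorem stretch_of_mem_realization (hF : ∀ σ ∈ F, IsMinimalNonface K σ) {x : V → ℝ}
    (hx : x ∈ realization K) {s : ℝ} (hs : 0 ≤ s) : stretch F x s = x := by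
  rw [stretch, Finset.sum_eq_zero, add_zero]
  intro σ hσ
  have hσ' := (Set.Finite.mem_toFinset _).1 hσ
  rw [depth_eq_zero_of_supp_ne hF (realization_mono (le_addFaces hF) hx) hσ'
    fun h => supp_notMem hF hx (h ▸ hσ'), stretchFactor_zero_left hs]
  simp

theorem stretchHeight_of_supp_eq (hF : ∀ σ ∈ F, IsMinimalNonface K σ) {x : V → ℝ}
    (hx : x ∈ realization (addFaces K F hF)) {σ : Finset V} (hσ : σ ∈ F) (h : supp x = σ)
    (s : ℝ) : stretchHeight F x s = min 1 (1 - s + (1 + s) * depth σ x) := by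
  rw [stretchHeight, Finset.sum_eq_single σ]
  · intro τ hτ hne
    exact depth_eq_zero_of_supp_ne hF hx ((Set.Finite.mem_toFinset _).1 hτ)
      (h.trans_ne hne.symm)
  · intro h'
    exact absurd ((Set.Finite.mem_toFinset _).2 hσ) h'

theorem stretchHeight_of_mem_realization (hF : ∀ σ ∈ F, IsMinimalNonface K σ) {x : V → ℝ}
    (hx : x ∈ realization K) {s : ℝ} (hs : 0 ≤ s) : stretchHeight F x s = 1 - s := by
  rw [stretchHeight, Finset.sum_eq_zero]
  · simp [hs]
  · intro σ hσ
    have hσ' := (Set.Finite.mem_toFinset _).1 hσ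
    exact depth_eq_zero_of_supp_ne hF (realization_mono (le_addFaces hF) hx) hσ'
      fun h => supp_notMem hF hx (h ▸ hσ')

theorem sum_depth_nonneg {x : V → ℝ} (hx : x ∈ stdSimplex ℝ V) :
    0 ≤ ∑ σ ∈ (Set.toFinite F).toFinset, depth σ x :=
  Finset.sum_nonneg fun _ _ => depth_nonneg hx.1

theorem stretchHeight_zero {x : V → ℝ} (hx : x ∈ stdSimplex ℝ V) : stretchHeight F x 0 = 1 := by
  have := sum_depth_nonneg (F := F) hx
  simpa [stretchHeight] using this

theorem stretchHeight_mem {x : V → ℝ} (hx : x ∈ stdSimplex ℝ V) (s : unitInterval) :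
    stretchHeight F x s ∈ unitInterval := by
  have h := sum_depth_nonneg (F := F) hx
  refine ⟨le_min zero_le_one ?_, min_le_left _ _⟩
  have h₁ := s.2.1
  have h₂ := s.2.2
  nlinarith [mul_nonneg (add_nonneg zero_le_one h₁) h]

theorem stretch_mem_closedFace (hF : ∀ σ ∈ F, IsMinimalNonface K σ) {x : V → ℝ}
    (hx : x ∈ realization (addFaces K F hF)) {σ : Finset V} (hσ : σ ∈ F) (h : supp x = σ)
    {s : ℝ} (hs : 0 ≤ s) : stretch F x s ∈ closedFace σ := by
  have hσn := (hF σ hσ).1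
  have hc : (0 : ℝ) < σ.card := by exact_mod_cast hσn.card_pos
  rw [stretch_of_supp_eq hF hx hσ h hs]
  have h0 : ∀ v, v ∉ σ → x v = 0 := supp_subset_iff.1 h.le
  have h0' : ∀ v, v ∉ σ → (x + (stretchFactor (depth σ x) s - 1) • (x - barycenter σ)) v = 0 := by
    intro v hv
    simp [barycenter, hv, h0 v hv]
  refine ⟨⟨fun v => ?_, ?_⟩, h0'⟩
  · by_cases hv : v ∈ σ
    · have h₁ := depth_le x hv
      have h₂ := stretchFactor_mul_le (m := depth σ x) hs
      have h₃ := stretchFactor_pos (m := depth σ x) hs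
      simp only [Pi.add_apply, Pi.smul_apply, Pi.sub_apply, smul_eq_mul, barycenter, if_pos hv]
      have h₄ : (σ.card : ℝ) * (1 / σ.card) = 1 := by field_simp
      refine le_of_mul_le_mul_left ?_ hc
      have h₅ := mul_le_mul_of_nonneg_left h₁ h₃.le
      linear_combination h₅ + h₂ + (stretchFactor (depth σ x) s - 1) * h₄
    · exact (h0' v hv).ge
  · simp only [Pi.add_apply, Pi.smul_apply, Pi.sub_apply, smul_eq_mul, Finset.sum_add_distrib,
      ← Finset.mul_sum, Finset.sum_sub_distrib, sum_barycenter hσn, hx.1.2]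
    ring

theorem stretch_mem (hF : ∀ σ ∈ F, IsMinimalNonface K σ) {x : V → ℝ}
    (hx : x ∈ realization (addFaces K F hF)) {s : ℝ} (hs : 0 ≤ s) :
    stretch F x s ∈ realization (addFaces K F hF) := by
  by_cases h : supp x ∈ F
  · have := stretch_mem_closedFace hF hx h rfl hs
    exact ⟨this.1, _, Or.inr h, this.2⟩
  · rwa [stretch_of_mem_realization hF (mem_realization_of_supp_notMem hF hx h) hs]

/-- The points that have entered the collar have been moved to the boundary of their face. -/
theorem stretch_mem_realization (hF : ∀ σ ∈ F, IsMinimalNonface K σ) {x : V → ℝ}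
    (hx : x ∈ realization (addFaces K F hF)) {s : ℝ} (hs : 0 ≤ s)
    (hh : stretchHeight F x s ≠ 1) : stretch F x s ∈ realization K := by
  by_cases h : supp x ∈ F
  · have hy := stretch_mem_closedFace hF hx h rfl hs
    rw [stretchHeight_of_supp_eq hF hx h rfl, Ne, min_eq_left_iff, not_le] at hh
    have e := stretchFactor_mul_eq hs (show (1 + s) * depth (supp x) x < s by linarith)
    obtain ⟨v, hv, hd⟩ := exists_depth_eq (hF _ h).1 x
    have hc : ((supp x).card : ℝ) ≠ 0 := by exact_mod_cast (hF _ h).1.card_pos.ne'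
    have hv0 : stretch F x s v = 0 := by
      rw [stretch_of_supp_eq hF hx h rfl hs]
      simp only [Pi.add_apply, Pi.smul_apply, Pi.sub_apply, smul_eq_mul, barycenter, if_pos hv]
      have h₄ : ((supp x).card : ℝ) * (1 / (supp x).card) = 1 := by field_simp
      refine (mul_eq_zero.1 ?_).resolve_left hc
      linear_combination -stretchFactor (depth (supp x) x) s * hd - e -
        (stretchFactor (depth (supp x) x) s - 1) * h₄
    refine mem_realization_iff.2 ⟨hy.1, (hF _ h).2.2 _ ?_ (supp_nonempty hy.1)⟩
    refine (Finset.ssubset_iff_of_subset (supp_subset_iff.2 hy.2)).2 ⟨v, hv, ?_⟩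
    rw [mem_supp, not_not, hv0]
  · have hxK := mem_realization_of_supp_notMem hF hx h
    rwa [stretch_of_mem_realization hF hxK hs]

theorem continuous_stretch (F : Set (Finset V)) :
    Continuous fun p : (V → ℝ) × unitInterval => stretch F p.1 p.2 := by
  refine continuous_fst.add (continuous_finsetSum _ fun σ _ => ?_)
  have hd : Continuous fun p : (V → ℝ) × unitInterval => depth σ p.1 :=
    (continuous_depth σ).comp continuous_fst
  have h₁ : ∀ p : (V → ℝ) × unitInterval, (1 + (p.2 : ℝ)) ≠ 0 := fun p => by
    have := p.2.2.1
    positivity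
  have h₂ : Continuous fun p : (V → ℝ) × unitInterval => (1 + (p.2 : ℝ))⁻¹ :=
    (by fun_prop : Continuous fun p : (V → ℝ) × unitInterval => 1 + (p.2 : ℝ)).inv₀ h₁
  have h₃ : Continuous fun p : (V → ℝ) × unitInterval => stretchFactor (depth σ p.1) p.2 := by
    refine ((continuous_const.sub hd).max h₂).inv₀ fun p => ?_
    exact (inv_pos.1 (stretchFactor_pos p.2.2.1)).ne'
  exact (h₃.sub continuous_const).smul (continuous_fst.sub continuous_const)

theorem continuous_stretchHeight (F : Set (Finset V)) :
    Continuous fun p : (V → ℝ) × unitInterval => stretchHeight F p.1 p.2 := by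
  have hd : Continuous fun p : (V → ℝ) × unitInterval => ∑ σ ∈ (Set.toFinite F).toFinset, depth σ p.1 :=
    continuous_finsetSum _ fun σ _ => (continuous_depth σ).comp continuous_fst
  unfold stretchHeight
  fun_prop

/-- The collapse of `K` in the complex obtained by adding minimal non-faces. -/
def collaredCollapse (hF : ∀ σ ∈ F, IsMinimalNonface K σ) :
    CollaredCollapse (realization K) (realization (addFaces K F hF)) (SphereWedge F) where
  incl := realizationIncl (le_addFaces hF)
  isClosedEmbedding := isClosedEmbedding_realizationIncl _
  proj := collapseMap hF
  base := SphereWedge.base F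
  isQuotientMap := isQuotientMap_collapse hF
  proj_incl x := collapse_of_notMem hF (supp_notMem hF x.2)
  eq_or_of_proj_eq a a' h := by
    by_cases ha : supp a.1 ∈ F
    · exact Or.inl (Subtype.ext (collapse_injOn hF a.2.1 a'.2.1 ha h))
    · by_cases ha' : supp a'.1 ∈ F
      · exact Or.inl (Subtype.ext (collapse_injOn hF a'.2.1 a.2.1 ha' h.symm).symm)
      · exact Or.inr ⟨⟨⟨a, mem_realization_of_supp_notMem hF a.2 ha⟩, rfl⟩,
          ⟨⟨a', mem_realization_of_supp_notMem hF a'.2 ha'⟩, rfl⟩⟩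
  mem_of_proj_eq_base a h :=
    ⟨⟨a, mem_realization_of_supp_notMem hF a.2
      fun ha => collapse_ne_base hF a.2.1 ha h⟩, rfl⟩
  push :=
    { toFun := fun z => ⟨stretch F z.1 z.2, stretch_mem hF z.1.2 z.2.2.1⟩
      continuous_toFun := ((continuous_stretch F).comp
        (f := fun z : realization (addFaces K F hF) × unitInterval => ((z.1 : V → ℝ), z.2))
        (by fun_prop)).subtype_mk _ }
  height :=
    { toFun := fun z => ⟨stretchHeight F z.1 z.2, stretchHeight_mem z.1.2.1 z.2⟩
      continuous_toFun := ((continuous_stretchHeight F).comp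
        (f := fun z : realization (addFaces K F hF) × unitInterval => ((z.1 : V → ℝ), z.2))
        (by fun_prop)).subtype_mk _ }
  push_zero a := by
    refine Subtype.ext ?_
    change stretch F a ((0 : unitInterval) : ℝ) = a
    by_cases h : supp a.1 ∈ F
    · simp [stretch_of_supp_eq hF a.2 h rfl, stretchFactor_zero_right (depth_nonneg a.2.1.1)]
    · exact stretch_of_mem_realization hF (mem_realization_of_supp_notMem hF a.2 h) le_rfl
  height_zero a := Subtype.ext (stretchHeight_zero a.2.1)
  push_incl x s := Subtype.ext (stretch_of_mem_realization hF x.2 s.2.1)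
  height_incl x s := Subtype.ext (stretchHeight_of_mem_realization hF x.2 s.2.1)
  push_mem a s h :=
    ⟨⟨stretch F a s, stretch_mem_realization hF a.2 s.2.1 fun h' => h (Subtype.ext h')⟩, rfl⟩

/-- A contraction of the realization of the filled complex. -/
theorem IsFilling.exists_contraction (h : IsFilling K F) :
    ∃ a₀, Nonempty ((ContinuousMap.id (realization (addFaces K F h.minimal))).Homotopy
      (ContinuousMap.const _ a₀)) :=
  haveI := h.contractible
  id_nullhomotopic _

end Stretch

end Fillable

end

theorem proposition2p10 {V : Type*} [Fintype V] :
    ∃ ε : ∀ (K : PreAbstractSimplicialComplex V) (F : Set (Finset V)), Fillable.IsFilling K F →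
        ContinuousMap.HomotopyEquiv (Fillable.Suspension (Fillable.realization K))
          (Fillable.SphereWedge F),
      (∀ (K : PreAbstractSimplicialComplex V) (F : Set (Finset V)) (hK : Fillable.IsFilling K F),
        (ε K F hK).toFun (Fillable.Suspension.base (Fillable.realization K)) =
          Fillable.SphereWedge.base F) ∧
      ∀ (K : PreAbstractSimplicialComplex V) (F : Set (Finset V)) (hK : Fillable.IsFilling K F)
        (L : PreAbstractSimplicialComplex V) (G : Set (Finset V)) (hL : Fillable.IsFilling L G)
        (hLK : L ≤ K), G ⊆ F ∪ K.faces →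
        ContinuousMap.HomotopicRel
          ((Fillable.SphereWedge.map G F).comp (ε L G hL).toFun)
          ((ε K F hK).toFun.comp (Fillable.Suspension.map (Fillable.realizationIncl hLK)))
          {Fillable.Suspension.base (Fillable.realization L)} := by
  refine ⟨fun K F hK => (Fillable.collaredCollapse hK.minimal).homotopyEquiv
    hK.exists_contraction.choose_spec.some, fun K F hK => rfl, ?_⟩
  intro K F hK L G hL hLK hGF
  have hle : Fillable.addFaces L G hL.minimal ≤ Fillable.addFaces K F hK.minimal := by
    rintro s (hs | hs)
    · exact Or.inl (hLK hs)
    · exact (hGF hs).symm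
  exact (Fillable.collaredCollapse hK.minimal).homotopicRel_suspensionMap
    hK.exists_contraction.choose_spec.some (Fillable.collaredCollapse hL.minimal)
    hL.exists_contraction.choose_spec.some (Fillable.realizationIncl hLK)
    (Fillable.realizationIncl hle) (Fillable.SphereWedge.map G F) (fun _ => rfl)
    (fun a => Fillable.collapse_naturality hK.minimal hL.minimal hLK a.2) rfl
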